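/- Let $d\ge 2$, $\alpha\in(0,d)$, $\delta>0$, $m\ge \omega_d\delta^d$ and $Q\ge 0$, where $\omega_d$ is the Lebesgue measure of the unit ball of $\mathbb{R}^d$. For a Borel set $A\subset\mathbb{R}^d$ let $$\mathcal I_\alpha(A)=\inf\left\{\int_{\mathbb{R}^d}\int_{\mathbb{R}^d}\frac{d\mu(x)\,d\mu(y)}{|x-y|^\alpha}\ :\ \mu \text{ a nonnegative Borel measure on } \mathbb{R}^d,\ \mu(A)=1\right\}\in[0,+\infty],$$ where the kernel is $+\infty$ for $x=y$, and let $$P(E)=\sup\left\{\int_E \operatorname{div}\varphi\,dx\ :\ \varphi\in C^1_c(\mathbb{R}^d;\mathbb{R}^d),\ |\varphi|\le 1\right\}$$ be the perimeter of $E$. Define, with values in $[0,+\infty]$ and with the convention $0\cdot\infty=0$, $$\mathcal F_{\alpha,Q}(E)=P(E)+Q^2\,\mathcal I_\alpha(E),\qquad \mathcal G_{\alpha,Q}(E)=P(E)+Q^2\,\mathcal I_\alpha(\partial E).$$ A set $E\subset\mathbb{R}^d$ satisfies the $\delta$-ball condition if for every $x\in\partial E$ there are an open ball of radius $\delta$ contained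 in $E$ and an open ball of radius $\delta$ contained in $E^c$ that both have $x$ on their boundary. Let $\mathcal K_\delta^{co}$ be the class of all closed connected subsets of $\mathbb{R}^d$ which satisfy the $\delta$-ball condition. Then both problems $$\min\left\{\mathcal F_{\alpha,Q}(E)\ :\ |E|=m,\ E\in\mathcal K_\delta^{co}\right\},\qquad \min\left\{\mathcal G_{\alpha,Q}(E)\ :\ |E|=m,\ E\in\mathcal K_\delta^{co}\right\}$$ have a solution. -/

import Mathlib

open MeasureTheory Metric Set
open scoped ENNReal

noncomputable section

namespace LiquidDrop

/-- The divergence of a vector field on Euclidean space. -/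
def divergence {d : ℕ} (φ : EuclideanSpace ℝ (Fin d) → EuclideanSpace ℝ (Fin d))
    (x : EuclideanSpace ℝ (Fin d)) : ℝ :=
  ∑ i, (fderiv ℝ φ x (EuclideanSpace.single i 1)) i

/-- The (De Giorgi) perimeter, i.e. the total variation of the characteristic function of `E`:
the supremum of `∫_E div φ` over all `C¹` compactly supported vector fields `φ` with `|φ| ≤ 1`. -/
def perimeter {d : ℕ} (E : Set (EuclideanSpace ℝ (Fin d))) : ℝ≥0∞ :=
  ⨆ (φ : EuclideanSpace ℝ (Fin d) → EuclideanSpace ℝ (Fin d))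
    (_ : ContDiff ℝ 1 φ ∧ HasCompactSupport φ ∧ ∀ x, ‖φ x‖ ≤ 1),
    ENNReal.ofReal (∫ x in E, divergence φ x)

/-- The interaction energy `∫∫ |x - y|^{-α} dμ(x) dν(y)` of two nonnegative Borel measures;
the kernel has the value `∞` on the diagonal (for `α > 0`). -/
def interactionEnergy {d : ℕ} (α : ℝ) (μ ν : Measure (EuclideanSpace ℝ (Fin d))) : ℝ≥0∞ :=
  ∫⁻ y, ∫⁻ x, (edist x y ^ α)⁻¹ ∂μ ∂ν

/-- The Riesz potential energy of a set: the infimum of the self-interaction energies of the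
nonnegative Borel measures that give mass one to `A`. -/
def rieszEnergy {d : ℕ} (α : ℝ) (A : Set (EuclideanSpace ℝ (Fin d))) : ℝ≥0∞ :=
  ⨅ (μ : Measure (EuclideanSpace ℝ (Fin d))) (_ : μ A = 1), interactionEnergy α μ μ

/-- `F(E) = P(E) + Q² I_α(E)`, with the convention `0 · ∞ = 0`. -/
def functionalF {d : ℕ} (α Q : ℝ) (E : Set (EuclideanSpace ℝ (Fin d))) : ℝ≥0∞ :=
  perimeter E + ENNReal.ofReal (Q ^ 2) * rieszEnergy α E

/-- `G(E) = P(E) + Q² I_α(∂E)`, with the convention `0 · ∞ = 0`. -/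
def functionalG {d : ℕ} (α Q : ℝ) (E : Set (EuclideanSpace ℝ (Fin d))) : ℝ≥0∞ :=
  perimeter E + ENNReal.ofReal (Q ^ 2) * rieszEnergy α (frontier E)

/-- At each boundary point `x` there is an open ball of radius `δ` contained in `E` and touching
the boundary of `E` at `x`. -/
def InternalBallCondition {d : ℕ} (δ : ℝ) (E : Set (EuclideanSpace ℝ (Fin d))) : Prop :=
  ∀ x ∈ frontier E, ∃ y, dist x y = δ ∧ ball y δ ⊆ E

/-- At each boundary point `x` there is an open ball of radius `δ` contained in the complement of
`E` and touching the boundary of `E` at `x`. -/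
def ExternalBallCondition {d : ℕ} (δ : ℝ) (E : Set (EuclideanSpace ℝ (Fin d))) : Prop :=
  ∀ x ∈ frontier E, ∃ y, dist x y = δ ∧ ball y δ ⊆ Eᶜ

/-- The `δ`-ball condition. -/
def BallCondition {d : ℕ} (δ : ℝ) (E : Set (EuclideanSpace ℝ (Fin d))) : Prop :=
  InternalBallCondition δ E ∧ ExternalBallCondition δ E

/-- The class of closed sets in `ℝ^d` satisfying the `δ`-ball condition. -/
def ballClass (d : ℕ) (δ : ℝ) : Set (Set (EuclideanSpace ℝ (Fin d))) :=
  {E | IsClosed E ∧ BallCondition δ E}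

/-- The connected sets of `ballClass d δ`. -/
def connectedBallClass (d : ℕ) (δ : ℝ) : Set (Set (EuclideanSpace ℝ (Fin d))) :=
  {E | E ∈ ballClass d δ ∧ IsConnected E}

/-- The competitors: the sets of the connected class whose Lebesgue measure is `m`. -/
def competitors (d : ℕ) (δ m : ℝ) : Set (Set (EuclideanSpace ℝ (Fin d))) :=
  {E | E ∈ connectedBallClass d δ ∧ volume E = ENNReal.ofReal m}

end LiquidDrop

end

/-! The proof is the direct method. A competitor is connected and each of its points is close to a
ball of radius `δ` inside it, so a long competitor would contain too many disjoint balls for the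
volume `m` (`dist_le_of_mem_competitors`). After translation, a minimizing sequence thus lies in a
fixed compact ball, and both the sets and their boundaries have Vietoris-convergent subsequences.

The ball condition makes this convergence strong. The touching balls have convergent centres along a
subsequence, so they survive in the limit, and the limit of the boundaries is exactly the boundary
of the limit (`limit_subset_frontier`, `VietorisTendsto.frontier_subset`). That boundary is null by
Lebesgue density, and off it membership is eventually constant. Indicators therefore converge almost
everywhere: volume passes to the limit and perimeter is lower semicontinuous.

For the Riesz term, near-optimal measures live in a common compact set, so they have a weak limit.
It is carried by the limit set, and the energy is weakly lower semicontinuous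
(`rieszEnergy_le_liminf`). The argument applies equally to the sets and to their boundaries, which
gives both problems at once. -/

open Filter Topology TopologicalSpace

namespace LiquidDrop

/-! ### Vietoris limits of sequences of sets -/

section VietorisLimits

variable {X : Type*}

/-- Convergence of a sequence of sets in the Vietoris topology. -/
def VietorisTendsto [TopologicalSpace X] (A : ℕ → Set X) (B : Set X) : Prop :=
  (∀ U, IsOpen U → B ⊆ U → ∀ᶠ n in atTop, A n ⊆ U) ∧
    ∀ U, IsOpen U → (B ∩ U).Nonempty → ∀ᶠ n in atTop, (A n ∩ U).Nonempty

theorem VietorisTendsto.comp [TopologicalSpace X] {A : ℕ → Set X} {B : Set X}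
    (h : VietorisTendsto A B) {σ : ℕ → ℕ} (hσ : StrictMono σ) :
    VietorisTendsto (A ∘ σ) B :=
  ⟨fun U hU hB => hσ.tendsto_atTop.eventually (h.1 U hU hB),
    fun U hU hB => hσ.tendsto_atTop.eventually (h.2 U hU hB)⟩

theorem exists_vietorisTendsto_subseq [MetricSpace X] {K : Set X} (hK : IsCompact K)
    {A : ℕ → Set X} (hne : ∀ n, (A n).Nonempty) (hcl : ∀ n, IsClosed (A n))
    (hsub : ∀ n, A n ⊆ K) :
    ∃ B : Set X, B.Nonempty ∧ IsCompact B ∧ B ⊆ K ∧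
      ∃ σ : ℕ → ℕ, StrictMono σ ∧ VietorisTendsto (A ∘ σ) B := by
  let u : ℕ → NonemptyCompacts X := fun n =>
    ⟨⟨A n, hK.of_isClosed_subset (hcl n) (hsub n)⟩, hne n⟩
  obtain ⟨B, hBK, σ, hσ, hlim⟩ :=
    (NonemptyCompacts.isCompact_subsets_of_isCompact hK).tendsto_subseq (x := u) hsub
  refine ⟨B, B.nonempty, B.isCompact, hBK, σ, hσ, fun U hU hB => ?_, fun U hU hB => ?_⟩
  · exact hlim.eventually ((NonemptyCompacts.isOpen_subsets_of_isOpen hU).mem_nhds hB)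
  · exact hlim.eventually ((NonemptyCompacts.isOpen_inter_nonempty_of_isOpen hU).mem_nhds hB)

/-- A splitting of the compact limit into two relatively open pieces can be thickened to disjoint
open sets; these would split `A n` for large `n`. -/
theorem VietorisTendsto.isPreconnected [TopologicalSpace X] [T2Space X] {A : ℕ → Set X}
    {B : Set X} (h : VietorisTendsto A B) (hB : IsCompact B)
    (hA : ∀ n, IsPreconnected (A n)) : IsPreconnected B := by
  intro U V hU hV hUV hBU hBV
  by_contra hne
  have hdisj : Disjoint (B \ V) (B \ U) := by
    rw [Set.disjoint_left]
    rintro x ⟨hx, hxV⟩ ⟨-, hxU⟩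
    exact (hUV hx).elim hxU hxV
  obtain ⟨U', V', hU', hV', hBU', hBV', hd⟩ :=
    SeparatedNhds.of_isCompact_isCompact (hB.diff hV) (hB.diff hU) hdisj
  have hcov : B ⊆ U' ∪ V' := by
    intro x hx
    by_cases hxV : x ∈ V
    · exact Or.inr (hBV' ⟨hx, fun hxU => hne ⟨x, hx, hxU, hxV⟩⟩)
    · exact Or.inl (hBU' ⟨hx, hxV⟩)
  have hneU : (B ∩ U').Nonempty := by
    obtain ⟨x, hx, hxU⟩ := hBU
    exact ⟨x, hx, hBU' ⟨hx, fun hxV => hne ⟨x, hx, hxU, hxV⟩⟩⟩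
  have hneV : (B ∩ V').Nonempty := by
    obtain ⟨x, hx, hxV⟩ := hBV
    exact ⟨x, hx, hBV' ⟨hx, fun hxU => hne ⟨x, hx, hxU, hxV⟩⟩⟩
  obtain ⟨n, h1, h2, h3⟩ := ((h.1 _ (hU'.union hV') hcov).and
    ((h.2 _ hU' hneU).and (h.2 _ hV' hneV))).exists
  obtain ⟨x, -, hxU, hxV⟩ := hA n U' V' hU' hV' h1 h2 h3
  exact Set.disjoint_left.1 hd hxU hxV

theorem VietorisTendsto.eventually_disjoint_closedBall [MetricSpace X] [ProperSpace X]
    {A : ℕ → Set X} {B : Set X} (h : VietorisTendsto A B) (hB : IsClosed B) {x : X}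
    (hx : x ∉ B) : ∃ r > 0, ∀ᶠ n in atTop, Disjoint (A n) (closedBall x r) := by
  obtain ⟨r, hr, hrB⟩ := nhds_basis_closedBall.mem_iff.1 (hB.isOpen_compl.mem_nhds hx)
  refine ⟨r, hr, (h.1 (closedBall x r)ᶜ isClosed_closedBall.isOpen_compl ?_).mono fun n hn => ?_⟩
  · exact fun y hy hyr => hrB hyr hy
  · exact Set.disjoint_left.2 fun y hy hyr => hn hy hyr

theorem VietorisTendsto.exists_tendsto_mem [MetricSpace X]
    {A : ℕ → Set X} {B : Set X} (h : VietorisTendsto A B) (hA : ∀ n, IsCompact (A n))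
    (hne : ∀ n, (A n).Nonempty) {x : X} (hx : x ∈ B) :
    ∃ u : ℕ → X, (∀ n, u n ∈ A n) ∧ Tendsto u atTop (𝓝 x) := by
  choose u hu hux using fun n => (hA n).exists_infDist_eq_dist (hne n) x
  refine ⟨u, hu, Metric.tendsto_nhds.2 fun ε hε => ?_⟩
  filter_upwards [h.2 (ball x ε) isOpen_ball ⟨x, hx, mem_ball_self hε⟩] with n hn
  obtain ⟨y, hyA, hy⟩ := hn
  rw [dist_comm, ← hux n]
  exact (infDist_le_dist_of_mem hyA).trans_lt (by rwa [dist_comm])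

end VietorisLimits

/-! ### Stability of the ball condition and of boundaries -/

section BallCondition

variable {d : ℕ} {δ : ℝ}

/-- Balls of radius `δ` contained in sets `A n` and touching at converging points accumulate. -/
theorem exists_accumulation_ball {X : Type*} [MetricSpace X] [ProperSpace X] {A : ℕ → Set X}
    {u : ℕ → X} {x : X} (hu : Tendsto u atTop (𝓝 x))
    (h : ∀ n, ∃ y, dist (u n) y = δ ∧ ball y δ ⊆ A n) :
    ∃ y, dist x y = δ ∧ ∀ w ∈ ball y δ, ∃ r > 0, ∃ᶠ n in atTop, ball w r ⊆ A n := by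
  choose y hy hyA using h
  obtain ⟨C, hC⟩ := (isBounded_iff_subset_closedBall x).1 (isBounded_range_of_tendsto u hu)
  have hmem : ∀ n, y n ∈ closedBall x (C + δ) := fun n => by
    have h1 : dist (u n) x ≤ C := hC (mem_range_self n)
    have h2 := dist_triangle (y n) (u n) x
    have h3 : dist (y n) (u n) = δ := (dist_comm _ _).trans (hy n)
    exact mem_closedBall.2 (by linarith)
  obtain ⟨y', -, τ, hτ, hlim⟩ := (isCompact_closedBall x (C + δ)).tendsto_subseq hmem
  refine ⟨y', ?_, fun w hw => ⟨(δ - dist w y') / 2, by have := mem_ball.1 hw; linarith, ?_⟩⟩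
  · refine tendsto_nhds_unique ((hu.comp hτ.tendsto_atTop).dist hlim) ?_
    simp [hy]
  · have hpos : 0 < (δ - dist w y') / 2 := by have := mem_ball.1 hw; linarith
    -- The centres converge only along `τ`, hence "frequently" rather than "eventually".
    refine hτ.tendsto_atTop.frequently (Eventually.frequently ?_)
    filter_upwards [Metric.tendsto_nhds.1 hlim _ hpos] with n hn
    refine Subset.trans ?_ (hyA (τ n))
    refine ball_subset_ball' ?_
    have := dist_triangle w y' (y (τ n))
    rw [dist_comm y'] at this
    simp only [Function.comp_apply] at hn
    linarith

/-- A ball is connected, so without boundary points it lies wholly in the interior or wholly in the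
exterior of `E`. -/
theorem ball_subset_of_disjoint_frontier {E : Set (EuclideanSpace ℝ (Fin d))}
    {x : EuclideanSpace ℝ (Fin d)} {r : ℝ}
    (hne : (E ∩ ball x r).Nonempty) (hd : Disjoint (frontier E) (ball x r)) : ball x r ⊆ E := by
  have hsub : ball x r ⊆ interior E ∪ (closure E)ᶜ := fun y hy => by
    by_contra hy'
    simp only [mem_union, mem_compl_iff, not_or, not_not] at hy'
    exact Set.disjoint_left.1 hd ⟨hy'.2, hy'.1⟩ hy
  have hdisj : Disjoint (interior E) (closure E)ᶜ :=
    Set.disjoint_left.2 fun y hy hy' => hy' (subset_closure (interior_subset hy))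
  obtain ⟨z, hzE, hz⟩ := hne
  have hzI : z ∈ interior E := (hsub hz).resolve_right fun h => h (subset_closure hzE)
  exact ((convex_ball x r).isPreconnected.subset_left_of_subset_union isOpen_interior
    isClosed_closure.isOpen_compl hdisj hsub ⟨z, hz, hzI⟩).trans interior_subset

/-- Every point of a set with the internal ball condition is within `2δ` of the centre of a ball
of radius `δ` contained in the set. -/
theorem InternalBallCondition.exists_ball_subset (hδ : 0 < δ)
    {E : Set (EuclideanSpace ℝ (Fin d))} (hE : InternalBallCondition δ E)
    {x : EuclideanSpace ℝ (Fin d)} (hx : x ∈ E) : ∃ y, dist x y ≤ 2 * δ ∧ ball y δ ⊆ E := by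
  by_cases hd : Disjoint (frontier E) (ball x δ)
  · exact ⟨x, by simp [hδ.le], ball_subset_of_disjoint_frontier ⟨x, hx, mem_ball_self hδ⟩ hd⟩
  · obtain ⟨p, hp, hpx⟩ := Set.not_disjoint_iff.1 hd
    obtain ⟨y, hy, hyE⟩ := hE p hp
    refine ⟨y, ?_, hyE⟩
    have := dist_triangle x p y
    rw [mem_ball, dist_comm] at hpx
    linarith

variable {E : ℕ → Set (EuclideanSpace ℝ (Fin d))} {A Γ : Set (EuclideanSpace ℝ (Fin d))}

theorem VietorisTendsto.eventually_ball_subset (hA : VietorisTendsto E A)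
    (hΓ : VietorisTendsto (fun n => frontier (E n)) Γ) (hΓc : IsClosed Γ)
    {x : EuclideanSpace ℝ (Fin d)} (hxA : x ∈ A) (hxΓ : x ∉ Γ) :
    ∃ r > 0, ∀ᶠ n in atTop, ball x r ⊆ E n := by
  obtain ⟨r, hr, hd⟩ := hΓ.eventually_disjoint_closedBall hΓc hxΓ
  refine ⟨r, hr, ?_⟩
  filter_upwards [hd, hA.2 _ isOpen_ball ⟨x, hxA, mem_ball_self hr⟩] with n h1 h2
  exact ball_subset_of_disjoint_frontier h2 (h1.mono_right ball_subset_closedBall)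

theorem VietorisTendsto.subset_of_frequently_subset (hA : VietorisTendsto E A) (hAc : IsClosed A)
    {S : Set (EuclideanSpace ℝ (Fin d))} (hS : ∃ᶠ n in atTop, S ⊆ E n) : S ⊆ A := by
  intro w hw
  by_contra hwA
  obtain ⟨r, hr, hd⟩ := hA.eventually_disjoint_closedBall hAc hwA
  obtain ⟨n, h1, h2⟩ := (hS.and_eventually hd).exists
  exact Set.disjoint_left.1 h2 (h1 hw) (mem_closedBall_self hr.le)

/-- Near a point of `A` off `Γ`, the sets `E n` eventually contain a fixed ball, so the point is
interior to `A`. -/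
theorem VietorisTendsto.frontier_subset (hA : VietorisTendsto E A) (hAc : IsClosed A)
    (hΓ : VietorisTendsto (fun n => frontier (E n)) Γ) (hΓc : IsClosed Γ) : frontier A ⊆ Γ := by
  intro x hx
  by_contra hxΓ
  obtain ⟨r, hr, hsub⟩ := hA.eventually_ball_subset hΓ hΓc (hAc.frontier_subset hx) hxΓ
  exact hx.2 (mem_interior.2 ⟨_, hA.subset_of_frequently_subset hAc hsub.frequently,
    isOpen_ball, mem_ball_self hr⟩)

theorem exists_internal_ball_of_mem_limit (hA : VietorisTendsto E A) (hAc : IsClosed A)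
    (hΓ : VietorisTendsto (fun n => frontier (E n)) Γ)
    (hEc : ∀ n, IsCompact (E n)) (hfr : ∀ n, (frontier (E n)).Nonempty)
    (hE : ∀ n, InternalBallCondition δ (E n))
    {x : EuclideanSpace ℝ (Fin d)} (hx : x ∈ Γ) : ∃ y, dist x y = δ ∧ ball y δ ⊆ A := by
  obtain ⟨u, hu, hlim⟩ := hΓ.exists_tendsto_mem
    (fun n => (hEc n).of_isClosed_subset isClosed_frontier (hEc n).isClosed.frontier_subset) hfr hx
  obtain ⟨y, hy, hball⟩ := exists_accumulation_ball hlim fun n => hE n _ (hu n)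
  refine ⟨y, hy, fun w hw => ?_⟩
  obtain ⟨r, hr, hf⟩ := hball w hw
  exact hA.subset_of_frequently_subset hAc hf (mem_ball_self hr)

/-- A limit point inside the accumulated ball is impossible: a whole neighbourhood of it misses `E
n` infinitely often, while `E n` must eventually enter that neighbourhood. -/
theorem exists_external_ball_of_mem_limit (hA : VietorisTendsto E A)
    (hΓ : VietorisTendsto (fun n => frontier (E n)) Γ)
    (hEc : ∀ n, IsCompact (E n)) (hfr : ∀ n, (frontier (E n)).Nonempty)
    (hE : ∀ n, ExternalBallCondition δ (E n))
    {x : EuclideanSpace ℝ (Fin d)} (hx : x ∈ Γ) : ∃ y, dist x y = δ ∧ ball y δ ⊆ Aᶜ := by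
  obtain ⟨u, hu, hlim⟩ := hΓ.exists_tendsto_mem
    (fun n => (hEc n).of_isClosed_subset isClosed_frontier (hEc n).isClosed.frontier_subset) hfr hx
  obtain ⟨y, hy, hball⟩ := exists_accumulation_ball hlim fun n => hE n _ (hu n)
  refine ⟨y, hy, fun w hw hwA => ?_⟩
  obtain ⟨r, hr, hf⟩ := hball w hw
  obtain ⟨n, h1, z, hzE, hz⟩ :=
    (hf.and_eventually (hA.2 _ isOpen_ball ⟨w, hwA, mem_ball_self hr⟩)).exists
  exact h1 hz hzE

/-- The external balls prevent boundaries from collapsing into the interior of the limit: each point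
of `Γ` is in `A` and touches a ball outside `A`. -/
theorem limit_subset_frontier (hδ : 0 < δ) (hA : VietorisTendsto E A)
    (hAc : IsClosed A) (hΓ : VietorisTendsto (fun n => frontier (E n)) Γ)
    (hEc : ∀ n, IsCompact (E n)) (hfr : ∀ n, (frontier (E n)).Nonempty)
    (hE : ∀ n, ExternalBallCondition δ (E n)) :
    Γ ⊆ frontier A := by
  intro x hx
  obtain ⟨y, hy, hball⟩ := exists_external_ball_of_mem_limit hA hΓ hEc hfr hE hx
  have hxA : x ∈ A := by
    by_contra hxA
    obtain ⟨r, hr, hd⟩ := hA.eventually_disjoint_closedBall hAc hxA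
    obtain ⟨n, h1, z, hz, hzr⟩ :=
      (hd.and (hΓ.2 _ isOpen_ball ⟨x, hx, mem_ball_self hr⟩)).exists
    exact Set.disjoint_left.1 h1 ((hEc n).isClosed.frontier_subset hz)
      (ball_subset_closedBall hzr)
  rw [frontier_eq_closure_inter_closure]
  refine ⟨subset_closure hxA, closure_mono hball ?_⟩
  rw [closure_ball y hδ.ne']
  exact mem_closedBall.2 hy.le

end BallCondition

/-! ### Lower semicontinuity of the Riesz energy -/

section Riesz

variable {d : ℕ} {α : ℝ}

theorem continuous_rieszKernel {X : Type*} [PseudoEMetricSpace X] (α : ℝ) :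
    Continuous fun p : X × X => (edist p.1 p.2 ^ α)⁻¹ :=
  ((ENNReal.continuous_rpow_const).comp continuous_edist).inv

theorem interactionEnergy_eq_lintegral_prod (μ : Measure (EuclideanSpace ℝ (Fin d)))
    [SFinite μ] :
    interactionEnergy α μ μ = ∫⁻ p, (edist p.1 p.2 ^ α)⁻¹ ∂(μ.prod μ) :=
  (lintegral_prod_symm _ (continuous_rieszKernel α).measurable.aemeasurable).symm

theorem interactionEnergy_mono {μ ν : Measure (EuclideanSpace ℝ (Fin d))} (h : μ ≤ ν) :
    interactionEnergy α μ μ ≤ interactionEnergy α ν ν :=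
  lintegral_mono' h fun _ => lintegral_mono' h fun _ => le_rfl

/-- A continuous function with values in `[0, ∞]` has a lower semicontinuous integral under weak
convergence of probability measures. -/
theorem lintegral_le_liminf_of_tendsto {Ω : Type*} [MeasurableSpace Ω] [TopologicalSpace Ω]
    [PseudoMetrizableSpace Ω] [BorelSpace Ω] {f : Ω → ℝ≥0∞} (hf : Continuous f)
    {μ : ℕ → ProbabilityMeasure Ω} {ν : ProbabilityMeasure Ω} (h : Tendsto μ atTop (𝓝 ν)) :
    ∫⁻ x, f x ∂(ν : Measure Ω) ≤ liminf (fun n => ∫⁻ x, f x ∂(μ n : Measure Ω)) atTop := by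
  -- Truncation gives finite continuous functions, to which the portmanteau inequality applies;
  -- monotone convergence removes it.
  have hsup : ∀ x, f x = ⨆ k : ℕ, min (f x) k := fun x => by
    rw [← inf_iSup_eq, ENNReal.iSup_natCast, inf_top_eq]
  have hmono : Monotone fun (k : ℕ) x => min (f x) (k : ℝ≥0∞) := fun i j hij x =>
    min_le_min_left _ (by exact_mod_cast hij)
  rw [lintegral_congr hsup, lintegral_iSup (fun k => (hf.min continuous_const).measurable) hmono]
  refine iSup_le fun k => ?_
  have hne : ∀ x, min (f x) (k : ℝ≥0∞) ≠ ∞ := fun x =>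
    ((min_le_right _ _).trans_lt (ENNReal.natCast_lt_top k)).ne
  have hcont : Continuous fun x => (min (f x) (k : ℝ≥0∞)).toReal :=
    continuous_iff_continuousAt.2 fun x =>
      (ENNReal.tendsto_toReal (hne x)).comp (hf.min continuous_const).continuousAt
  have key := lintegral_le_liminf_lintegral_of_forall_isOpen_measure_le_liminf_measure hcont
    (fun x => ENNReal.toReal_nonneg)
    (fun G hG => ProbabilityMeasure.le_liminf_measure_open_of_tendsto h hG)
  simp_rw [ENNReal.ofReal_toReal (hne _)] at key
  refine key.trans (liminf_le_liminf (Eventually.of_forall fun n => lintegral_mono fun x => ?_))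
  exact min_le_left _ _

/-- Products of weakly convergent probability measures converge weakly, and the kernel is continuous
into `[0, ∞]`, diagonal included. -/
theorem interactionEnergy_le_liminf {μ : ℕ → ProbabilityMeasure (EuclideanSpace ℝ (Fin d))}
    {ν : ProbabilityMeasure (EuclideanSpace ℝ (Fin d))} (h : Tendsto μ atTop (𝓝 ν)) :
    interactionEnergy α (ν : Measure (EuclideanSpace ℝ (Fin d))) ν ≤
      liminf (fun n => interactionEnergy α (μ n : Measure (EuclideanSpace ℝ (Fin d))) (μ n))
        atTop := by
  simp_rw [interactionEnergy_eq_lintegral_prod]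
  exact lintegral_le_liminf_of_tendsto (continuous_rieszKernel α)
    ((ProbabilityMeasure.continuous_prod.tendsto (ν, ν)).comp (h.prodMk_nhds h))

/-- Mass carried by sets converging from above stays on the limit set. -/
theorem measure_limit_eq_one {X : Type*} [MetricSpace X] [ProperSpace X] [MeasurableSpace X]
    [BorelSpace X] {K : ℕ → Set X} {B : Set X} (hB : IsClosed B) (hK : VietorisTendsto K B)
    {μ : ℕ → ProbabilityMeasure X} {ν : ProbabilityMeasure X}
    (hμ : ∀ n, (μ n : Measure X) (K n)ᶜ = 0) (h : Tendsto μ atTop (𝓝 ν)) :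
    (ν : Measure X) B = 1 := by
  rw [← prob_compl_eq_zero_iff hB.measurableSet]
  refine measure_null_of_locally_null _ fun x hx => ?_
  obtain ⟨r, hr, hd⟩ := hK.eventually_disjoint_closedBall hB hx
  refine ⟨ball x r, mem_nhdsWithin_of_mem_nhds (ball_mem_nhds x hr), ?_⟩
  refine le_antisymm ((ProbabilityMeasure.le_liminf_measure_open_of_tendsto h
    isOpen_ball).trans ?_) zero_le
  have : (fun n => (μ n : Measure X) (ball x r)) =ᶠ[atTop] fun _ => 0 := by
    filter_upwards [hd] with n hn
    exact measure_mono_null (t := (K n)ᶜ)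
      (fun y hy hyK => Set.disjoint_left.1 hn hyK (ball_subset_closedBall hy)) (hμ n)
  rw [liminf_congr this, liminf_const]

theorem rieszEnergy_le_liminf {S : Set (EuclideanSpace ℝ (Fin d))} (hS : IsCompact S)
    {K : ℕ → Set (EuclideanSpace ℝ (Fin d))} {B : Set (EuclideanSpace ℝ (Fin d))}
    (hKc : ∀ n, IsClosed (K n)) (hKS : ∀ n, K n ⊆ S) (hB : IsClosed B)
    (hK : VietorisTendsto K B) :
    rieszEnergy α B ≤ liminf (fun n => rieszEnergy α (K n)) atTop := by
  refine le_of_forall_gt_imp_ge_of_dense fun c hc => ?_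
  obtain ⟨σ, hσ, hlt⟩ := extraction_of_frequently_atTop
    (frequently_lt_of_liminf_lt (by isBoundedDefault) hc)
  have hex : ∀ n, ∃ μ : ProbabilityMeasure (EuclideanSpace ℝ (Fin d)),
      (μ : Measure (EuclideanSpace ℝ (Fin d))) (K (σ n))ᶜ = 0 ∧
      interactionEnergy α (μ : Measure (EuclideanSpace ℝ (Fin d))) μ ≤ c := fun n => by
    obtain ⟨μ, hμ⟩ := iInf_lt_iff.1 (hlt n)
    obtain ⟨hμ1, hμc⟩ := iInf_lt_iff.1 hμ
    -- A competing measure may charge the complement, even infinitely; restriction yields a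
    -- probability measure without raising the energy.
    refine ⟨⟨μ.restrict (K (σ n)), ⟨by simpa using hμ1⟩⟩, ?_, ?_⟩
    · simp [Measure.restrict_apply (hKc _).measurableSet.compl]
    · exact (interactionEnergy_mono Measure.restrict_le_self).trans hμc.le
  choose μ hμ0 hμc using hex
  have hcpt := isCompact_setOfPred_probabilityMeasure_mass_eq_compl_isCompact_le
    (u := fun _ => 0) (K := fun _ => S) tendsto_const_nhds (fun _ => hS) (Or.inl inferInstance)
  have hmem : ∀ n, μ n ∈ {μ : ProbabilityMeasure (EuclideanSpace ℝ (Fin d)) |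
      ∀ k : ℕ, μ ((fun _ => S) k)ᶜ ≤ (fun _ => 0) k} := fun n k => by
    refine le_of_eq ((ProbabilityMeasure.null_iff_toMeasure_null _ _).2 ?_)
    exact measure_mono_null (compl_subset_compl.2 (hKS _)) (hμ0 n)
  -- Metrizability of the weak topology turns compactness into sequential compactness.
  let _ := TopologicalSpace.metrizableSpaceMetric
    (ProbabilityMeasure (EuclideanSpace ℝ (Fin d)))
  obtain ⟨ν, -, τ, hτ, hlim⟩ := hcpt.tendsto_subseq hmem
  have hν : (ν : Measure (EuclideanSpace ℝ (Fin d))) B = 1 :=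
    measure_limit_eq_one hB (hK.comp (hσ.comp hτ)) (fun n => hμ0 (τ n)) hlim
  calc rieszEnergy α B ≤ interactionEnergy α (ν : Measure (EuclideanSpace ℝ (Fin d))) ν :=
        iInf₂_le (f := fun μ (_ : μ B = 1) => interactionEnergy α μ μ) _ hν
    _ ≤ _ := interactionEnergy_le_liminf hlim
    _ ≤ liminf (fun _ : ℕ => c) atTop :=
        liminf_le_liminf (Eventually.of_forall fun n => hμc (τ n))
    _ = c := liminf_const c

theorem rieszEnergy_image_le (e : EuclideanSpace ℝ (Fin d) ≃ᵢ EuclideanSpace ℝ (Fin d))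
    (A : Set (EuclideanSpace ℝ (Fin d))) : rieszEnergy α (e '' A) ≤ rieszEnergy α A := by
  refine le_iInf₂ fun μ hμ => ?_
  have he : MeasurableEmbedding e := e.toHomeomorph.measurableEmbedding
  refine (iInf₂_le (μ.map e) ?_).trans (le_of_eq ?_)
  · rw [he.map_apply, preimage_image_eq _ e.injective, hμ]
  · simp [interactionEnergy, he.lintegral_map, e.edist_eq]

theorem rieszEnergy_image (e : EuclideanSpace ℝ (Fin d) ≃ᵢ EuclideanSpace ℝ (Fin d))
    (A : Set (EuclideanSpace ℝ (Fin d))) : rieszEnergy α (e '' A) = rieszEnergy α A := by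
  refine le_antisymm (rieszEnergy_image_le e A) ?_
  have := rieszEnergy_image_le (α := α) e.symm (e '' A)
  rwa [← image_comp, e.symm_comp_self, image_id] at this

end Riesz

/-! ### Null boundaries and perimeter -/

section Measure

variable {d : ℕ} {δ : ℝ}

theorem volume_real_ball_eq (x : EuclideanSpace ℝ (Fin d)) {r : ℝ} (hr : 0 < r) :
    volume.real (ball x r) = r ^ d * volume.real (ball (0 : EuclideanSpace ℝ (Fin d)) 1) := by
  rw [measureReal_def, Measure.addHaar_ball_of_pos volume x hr, ENNReal.toReal_mul,
    ENNReal.toReal_ofReal (by positivity), finrank_euclideanSpace_fin, measureReal_def]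

/-- The external ball keeps the density of `E` at a boundary point at most `1 - 2⁻ᵈ` on small
scales, whereas almost every point of `E` has density one. -/
theorem ExternalBallCondition.volume_frontier (hδ : 0 < δ)
    {E : Set (EuclideanSpace ℝ (Fin d))} (hEc : IsClosed E) (hE : ExternalBallCondition δ E) :
    volume (frontier E) = 0 := by
  have hae := (ae_restrict_iff' hEc.measurableSet).1
    (Besicovitch.ae_tendsto_measure_inter_div
      (volume : Measure (EuclideanSpace ℝ (Fin d))) E)
  refine measure_mono_null (fun x hx => ?_) (ae_iff.1 hae)
  simp only [mem_ofPred_eq, Classical.not_imp]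
  refine ⟨hEc.frontier_subset hx, fun hlim => ?_⟩
  obtain ⟨z, hz, hball⟩ := hE x hx
  set c : ℝ := 1 - (1 / 2) ^ d with hc
  have hc1 : c < 1 := by
    have : (0 : ℝ) < (1 / 2) ^ d := by positivity
    linarith
  have hbound : ∀ᶠ r in 𝓝[>] (0 : ℝ),
      volume (E ∩ closedBall x r) / volume (closedBall x r) ≤ ENNReal.ofReal c := by
    filter_upwards [Ioc_mem_nhdsGT hδ] with r ⟨hr0, hrδ⟩
    -- The ball of radius `r / 2` touching `x` from inside the external ball also fits in
    -- `closedBall x r`.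
    set y : EuclideanSpace ℝ (Fin d) := x + (r / 2 / δ) • (z - x) with hy
    have hxz : ‖z - x‖ = δ := by rw [← dist_eq_norm, dist_comm, hz]
    have hyx : dist y x = r / 2 := by
      rw [dist_eq_norm, hy, add_sub_cancel_left, norm_smul, hxz, Real.norm_of_nonneg (by positivity)]
      field_simp
    have hyz : dist y z = δ - r / 2 := by
      have : y - z = -(1 - r / 2 / δ) • (z - x) := by rw [hy]; module
      have h1 : r / 2 / δ ≤ 1 := by rw [div_le_one hδ]; linarith
      rw [dist_eq_norm, this, neg_smul, norm_neg, norm_smul, hxz,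
        Real.norm_of_nonneg (by linarith)]
      field_simp
    have hsub1 : ball y (r / 2) ⊆ closedBall x r :=
      (ball_subset_ball' (by rw [hyx]; linarith)).trans ball_subset_closedBall
    have hsub2 : ball y (r / 2) ⊆ Eᶜ := (ball_subset_ball' (by rw [hyz]; linarith)).trans hball
    have hsub3 : E ∩ closedBall x r ⊆ closedBall x r \ ball y (r / 2) :=
      fun w hw => ⟨hw.2, fun hw' => hsub2 hw' hw.1⟩
    have hreal : volume.real (E ∩ closedBall x r) ≤ c * volume.real (closedBall x r) := by
      have h1 : volume.real (E ∩ closedBall x r) ≤ volume.real (closedBall x r \ ball y (r / 2)) :=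
        measureReal_mono hsub3 (measure_ne_top_of_subset sdiff_subset measure_closedBall_lt_top.ne)
      rw [measureReal_sdiff hsub1 measurableSet_ball measure_closedBall_lt_top.ne] at h1
      rw [volume_real_ball_eq y (by positivity)] at h1
      rw [Measure.addHaar_real_closedBall _ _ hr0.le] at h1 ⊢
      refine h1.trans (le_of_eq ?_)
      rw [hc, finrank_euclideanSpace_fin, div_pow, div_pow, one_pow]
      ring
    have hpos := measure_closedBall_pos (volume : Measure (EuclideanSpace ℝ (Fin d))) x hr0
    rw [ENNReal.div_le_iff hpos.ne' measure_closedBall_lt_top.ne]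
    have hfin := (measure_closedBall_lt_top (μ := (volume : Measure (EuclideanSpace ℝ (Fin d))))
      (x := x) (r := r)).ne
    rw [← ENNReal.ofReal_toReal (measure_ne_top_of_subset inter_subset_right hfin),
      ← ENNReal.ofReal_toReal hfin, ← ENNReal.ofReal_mul' ENNReal.toReal_nonneg]
    exact ENNReal.ofReal_le_ofReal hreal
  have := le_of_tendsto hlim hbound
  exact hc1.not_ge (ENNReal.one_le_ofReal.1 this)

theorem continuous_divergence {φ : EuclideanSpace ℝ (Fin d) → EuclideanSpace ℝ (Fin d)}
    (hφ : ContDiff ℝ 1 φ) : Continuous (divergence φ) := by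
  have := hφ.continuous_fderiv one_ne_zero
  unfold divergence
  fun_prop

theorem integrable_divergence {φ : EuclideanSpace ℝ (Fin d) → EuclideanSpace ℝ (Fin d)}
    (hφ : ContDiff ℝ 1 φ) (hc : HasCompactSupport φ) : Integrable (divergence φ) := by
  refine (continuous_divergence hφ).integrable_of_hasCompactSupport ?_
  refine (hc.fderiv (𝕜 := ℝ)).mono fun x hx h0 => hx ?_
  simp [divergence, h0]

/-- For a fixed field the integral of the divergence converges by dominated convergence, and a
supremum of continuous quantities is lower semicontinuous. -/
theorem perimeter_le_liminf {E : ℕ → Set (EuclideanSpace ℝ (Fin d))}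
    {A : Set (EuclideanSpace ℝ (Fin d))} (hE : ∀ n, MeasurableSet (E n)) (hA : MeasurableSet A)
    (h : ∀ᵐ x, ∀ᶠ n in atTop, x ∈ E n ↔ x ∈ A) :
    perimeter A ≤ liminf (fun n => perimeter (E n)) atTop := by
  refine iSup₂_le fun φ hφ => ?_
  have hint := integrable_divergence hφ.1 hφ.2.1
  have hlim : Tendsto (fun n => ∫ x in E n, divergence φ x) atTop
      (𝓝 (∫ x in A, divergence φ x)) := by
    simp_rw [← integral_indicator (hE _), ← integral_indicator hA]
    refine tendsto_integral_of_dominated_convergence (fun x => ‖divergence φ x‖)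
      (fun n => (hint.indicator (hE n)).aestronglyMeasurable) hint.norm
      (fun n => ae_of_all _ fun x => norm_indicator_le_norm_self _ _) ?_
    filter_upwards [h] with x hx
    refine tendsto_const_nhds.congr' ?_
    filter_upwards [hx] with n hn
    by_cases hxA : x ∈ A
    · rw [indicator_of_mem hxA, indicator_of_mem (hn.2 hxA)]
    · rw [indicator_of_notMem hxA, indicator_of_notMem (mt hn.1 hxA)]
  rw [← ((ENNReal.continuous_ofReal.tendsto _).comp hlim).liminf_eq]
  refine liminf_le_liminf (Eventually.of_forall fun n => ?_)
  exact le_iSup₂ (f := fun (φ : EuclideanSpace ℝ (Fin d) → EuclideanSpace ℝ (Fin d))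
    (_ : ContDiff ℝ 1 φ ∧ HasCompactSupport φ ∧ ∀ x, ‖φ x‖ ≤ 1) =>
      ENNReal.ofReal (∫ x in E n, divergence φ x)) φ hφ

theorem perimeter_image_addRight_le (a : EuclideanSpace ℝ (Fin d))
    (E : Set (EuclideanSpace ℝ (Fin d))) :
    perimeter (IsometryEquiv.addRight a '' E) ≤ perimeter E := by
  refine iSup₂_le fun φ hφ => ?_
  have hdiv : ∀ x, divergence (fun y => φ (y + a)) x = divergence φ (x + a) := fun x => by
    simp only [divergence, fderiv_comp_add_right]
  have hmp : MeasurePreserving (IsometryEquiv.addRight a) (volume : Measure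
      (EuclideanSpace ℝ (Fin d))) volume := measurePreserving_add_right volume a
  have heq : ∫ x in IsometryEquiv.addRight a '' E, divergence φ x =
      ∫ x in E, divergence (fun y => φ (y + a)) x := by
    rw [hmp.setIntegral_image_emb
      (IsometryEquiv.addRight a).toHomeomorph.measurableEmbedding]
    exact integral_congr_ae (ae_of_all _ fun x => (hdiv x).symm)
  rw [heq]
  refine le_iSup₂ (f := fun (φ : EuclideanSpace ℝ (Fin d) → EuclideanSpace ℝ (Fin d))
    (_ : ContDiff ℝ 1 φ ∧ HasCompactSupport φ ∧ ∀ x, ‖φ x‖ ≤ 1) =>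
      ENNReal.ofReal (∫ x in E, divergence φ x)) (fun y => φ (y + a)) ⟨?_, ?_, fun x => hφ.2.2 _⟩
  · exact hφ.1.comp (contDiff_id.add contDiff_const)
  · exact hφ.2.1.comp_homeomorph (Homeomorph.addRight a)

theorem perimeter_image_addRight (a : EuclideanSpace ℝ (Fin d))
    (E : Set (EuclideanSpace ℝ (Fin d))) :
    perimeter (IsometryEquiv.addRight a '' E) = perimeter E := by
  refine le_antisymm (perimeter_image_addRight_le a E) ?_
  have := perimeter_image_addRight_le (-a) (IsometryEquiv.addRight a '' E)
  rwa [← IsometryEquiv.addRight_symm, ← image_comp, IsometryEquiv.symm_comp_self, image_id] at this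

end Measure

/-! ### Translation invariance -/

section Translation

variable {d : ℕ} {δ m : ℝ}

theorem InternalBallCondition.image (e : EuclideanSpace ℝ (Fin d) ≃ᵢ EuclideanSpace ℝ (Fin d))
    {E : Set (EuclideanSpace ℝ (Fin d))} (hE : InternalBallCondition δ E) :
    InternalBallCondition δ (e '' E) := by
  intro x hx
  obtain ⟨z, hz, rfl⟩ := (e.toHomeomorph.image_frontier E).ge hx
  obtain ⟨y, hy, hyE⟩ := hE z hz
  refine ⟨e y, by rw [← hy]; exact e.isometry.dist_eq z y, ?_⟩
  rw [← e.image_ball]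
  exact image_mono hyE

theorem ExternalBallCondition.image (e : EuclideanSpace ℝ (Fin d) ≃ᵢ EuclideanSpace ℝ (Fin d))
    {E : Set (EuclideanSpace ℝ (Fin d))} (hE : ExternalBallCondition δ E) :
    ExternalBallCondition δ (e '' E) := by
  intro x hx
  obtain ⟨z, hz, rfl⟩ := (e.toHomeomorph.image_frontier E).ge hx
  obtain ⟨y, hy, hyE⟩ := hE z hz
  refine ⟨e y, by rw [← hy]; exact e.isometry.dist_eq z y, ?_⟩
  rw [← e.image_ball, ← image_compl_eq e.bijective]
  exact image_mono hyE

theorem image_addRight_mem_competitors (a : EuclideanSpace ℝ (Fin d))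
    {E : Set (EuclideanSpace ℝ (Fin d))} (hE : E ∈ competitors d δ m) :
    IsometryEquiv.addRight a '' E ∈ competitors d δ m := by
  obtain ⟨⟨⟨hc, hi, ho⟩, hconn⟩, hv⟩ := hE
  refine ⟨⟨⟨?_, hi.image _, ho.image _⟩, ?_⟩, ?_⟩
  · exact (IsometryEquiv.addRight a).toHomeomorph.isClosedMap _ hc
  · exact hconn.image _ (IsometryEquiv.addRight a).continuous.continuousOn
  · rw [← hv]
    simp

theorem functionalF_image_addRight (α Q : ℝ) (a : EuclideanSpace ℝ (Fin d))
    (E : Set (EuclideanSpace ℝ (Fin d))) :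
    functionalF α Q (IsometryEquiv.addRight a '' E) = functionalF α Q E := by
  rw [functionalF, functionalF, perimeter_image_addRight, rieszEnergy_image]

theorem functionalG_image_addRight (α Q : ℝ) (a : EuclideanSpace ℝ (Fin d))
    (E : Set (EuclideanSpace ℝ (Fin d))) :
    functionalG α Q (IsometryEquiv.addRight a '' E) = functionalG α Q E := by
  have h : frontier (IsometryEquiv.addRight a '' E) = IsometryEquiv.addRight a '' frontier E :=
    ((IsometryEquiv.addRight a).toHomeomorph.image_frontier E).symm
  rw [functionalG, functionalG, perimeter_image_addRight, h, rieszEnergy_image]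

end Translation

/-! ### Bounded diameter, compactness and existence -/

section Compactness

variable {d : ℕ} {δ m : ℝ}

/-- Connected sets of given volume with the ball condition have bounded diameter. -/
theorem dist_le_of_mem_competitors (hδ : 0 < δ) (hm0 : 0 ≤ m) {N : ℕ}
    (hN : m < N * (δ ^ d * volume.real (ball (0 : EuclideanSpace ℝ (Fin d)) 1)))
    {E : Set (EuclideanSpace ℝ (Fin d))} (hE : E ∈ competitors d δ m)
    {x y : EuclideanSpace ℝ (Fin d)} (hx : x ∈ E) (hy : y ∈ E) :
    dist y x ≤ 10 * δ * N := by
  by_contra! hlt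
  obtain ⟨⟨⟨-, hi, -⟩, hconn⟩, hv⟩ := hE
  -- By connectedness `E` meets the spheres of radii `10δk` about `x`. Moving to centres of inner
  -- balls costs at most `2δ` each, leaving gaps of at least `6δ`: the `N` balls are disjoint and
  -- their volume exceeds `m`.
  have hw : ∀ k ∈ Finset.range N, ∃ w ∈ E, dist w x = 10 * δ * k := fun k hk => by
    have hkN : (k : ℝ) ≤ N := by exact_mod_cast (Finset.mem_range.1 hk).le
    refine hconn.isPreconnected.intermediate_value hx hy
      (f := fun w => dist w x) (by fun_prop) ⟨?_, ?_⟩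
    · rw [dist_self]; positivity
    · exact (mul_le_mul_of_nonneg_left hkN (by positivity)).trans hlt.le
  have hc : ∀ k, ∃ c, k ∈ Finset.range N → ball c δ ⊆ E ∧
      |dist c x - 10 * δ * k| ≤ 2 * δ := fun k => by
    by_cases hk : k ∈ Finset.range N
    · obtain ⟨w, hwE, hwx⟩ := hw k hk
      obtain ⟨c, hcw, hcE⟩ := hi.exists_ball_subset hδ hwE
      refine ⟨c, fun _ => ⟨hcE, ?_⟩⟩
      rw [← hwx]
      exact (abs_dist_sub_le c w x).trans (by rwa [dist_comm])
    · exact ⟨x, fun h => absurd h hk⟩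
  choose c hc using hc
  have hdisj : Set.PairwiseDisjoint (Finset.range N : Set ℕ) fun k => ball (c k) δ := by
    have key : ∀ i j, i ∈ Finset.range N → j ∈ Finset.range N → i < j →
        Disjoint (ball (c i) δ) (ball (c j) δ) := fun i j hi hj hij => by
      refine ball_disjoint_ball ?_
      have h1 := abs_le.1 (hc i hi).2
      have h2 := abs_le.1 (hc j hj).2
      have h3 : (i : ℝ) + 1 ≤ j := by exact_mod_cast hij
      have h4 := dist_triangle (c j) (c i) x
      rw [dist_comm (c j) (c i)] at h4
      nlinarith
    intro i hi j hj hij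
    rcases lt_or_gt_of_ne hij with h | h
    · exact key i j hi hj h
    · exact (key j i hj hi h).symm
  have hsum : ∑ k ∈ Finset.range N, volume (ball (c k) δ) ≤ volume E := by
    rw [← measure_biUnion_finset hdisj fun _ _ => measurableSet_ball]
    exact measure_mono (iUnion₂_subset fun k hk => (hc k hk).1)
  rw [hv] at hsum
  have hreal := ENNReal.toReal_mono ENNReal.ofReal_ne_top hsum
  rw [ENNReal.toReal_sum fun _ _ => measure_ball_lt_top.ne, ENNReal.toReal_ofReal hm0] at hreal
  simp_rw [← measureReal_def, volume_real_ball_eq _ hδ] at hreal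
  rw [Finset.sum_const, Finset.card_range, nsmul_eq_mul] at hreal
  linarith

/-- Uniformly bounded sequences of competitors are precompact, and the perimeter and the Riesz
energies are lower semicontinuous along a convergent subsequence. -/
theorem exists_limit_of_competitors (hd : 0 < d) (hδ : 0 < δ) {R : ℝ}
    {E : ℕ → Set (EuclideanSpace ℝ (Fin d))} (hE : ∀ n, E n ∈ competitors d δ m)
    (hR : ∀ n, E n ⊆ closedBall 0 R) :
    ∃ A ∈ competitors d δ m, ∃ σ : ℕ → ℕ, StrictMono σ ∧
      perimeter A ≤ liminf (fun n => perimeter (E (σ n))) atTop ∧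
      ∀ α, rieszEnergy α A ≤ liminf (fun n => rieszEnergy α (E (σ n))) atTop ∧
        rieszEnergy α (frontier A) ≤
          liminf (fun n => rieszEnergy α (frontier (E (σ n)))) atTop := by
  have : Nonempty (Fin d) := ⟨⟨0, hd⟩⟩
  have hcl : ∀ n, IsClosed (E n) := fun n => (hE n).1.1.1
  have hne : ∀ n, (E n).Nonempty := fun n => (hE n).1.2.nonempty
  have hK := isCompact_closedBall (0 : EuclideanSpace ℝ (Fin d)) R
  have hfrR : ∀ n, frontier (E n) ⊆ closedBall 0 R := fun n =>
    (hcl n).frontier_subset.trans (hR n)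
  -- A bounded set is not the whole space because `d > 0`.
  have hfr : ∀ n, (frontier (E n)).Nonempty := fun n =>
    nonempty_frontier_iff.2 ⟨hne n, fun h =>
      NormedSpace.unbounded_univ ℝ (EuclideanSpace ℝ (Fin d))
        (h ▸ isBounded_closedBall.subset (hR n))⟩
  obtain ⟨A, hAne, hAc, -, σ, hσ, hA⟩ := exists_vietorisTendsto_subseq hK hne hcl hR
  obtain ⟨Γ, -, hΓc, -, τ, hτ, hΓ⟩ := exists_vietorisTendsto_subseq hK
    (fun n => hfr (σ n)) (fun n => isClosed_frontier) (fun n => hfrR (σ n))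
  replace hA := hA.comp hτ
  have hEc : ∀ n, IsCompact (E (σ (τ n))) := fun n => hK.of_isClosed_subset (hcl _) (hR _)
  have hAcl := hAc.isClosed
  have hΓA : Γ = frontier A := Subset.antisymm
    (limit_subset_frontier hδ hA hAcl hΓ hEc (fun n => hfr _) fun n => (hE _).1.1.2.2)
    (hA.frontier_subset hAcl hΓ hΓc.isClosed)
  subst hΓA
  have hint : InternalBallCondition δ A := fun x hx =>
    exists_internal_ball_of_mem_limit hA hAcl hΓ hEc (fun n => hfr _)
      (fun n => (hE _).1.1.2.1) hx
  have hext : ExternalBallCondition δ A := fun x hx =>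
    exists_external_ball_of_mem_limit hA hΓ hEc (fun n => hfr _)
      (fun n => (hE _).1.1.2.2) hx
  -- Off the null boundary, points of `A` have a neighbourhood eventually inside the sets, and
  -- points outside `A` one eventually disjoint from them.
  have hae : ∀ᵐ x : EuclideanSpace ℝ (Fin d), ∀ᶠ n in atTop, x ∈ E (σ (τ n)) ↔ x ∈ A := by
    filter_upwards [measure_eq_zero_iff_ae_notMem.1 (hext.volume_frontier hδ hAcl)] with x hx
    by_cases hxA : x ∈ A
    · obtain ⟨r, hr, h⟩ := hA.eventually_ball_subset hΓ hΓc.isClosed hxA hx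
      exact h.mono fun n hn => iff_of_true (hn (mem_ball_self hr)) hxA
    · obtain ⟨r, hr, h⟩ := hA.eventually_disjoint_closedBall hAcl hxA
      exact h.mono fun n hn => iff_of_false
        (fun hx => Set.disjoint_left.1 hn hx (mem_closedBall_self hr.le)) hxA
  have hvol : Tendsto (fun n => volume (E (σ (τ n)))) atTop (𝓝 (volume A)) :=
    tendsto_measure_of_ae_tendsto_indicator atTop hAcl.measurableSet
      (fun n => (hcl _).measurableSet) measurableSet_closedBall measure_closedBall_lt_top.ne
      (Eventually.of_forall fun n => hR _) hae
  have hpre : IsPreconnected A := hA.isPreconnected hAc fun n => (hE _).1.2.isPreconnected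
  refine ⟨A, ⟨⟨⟨hAcl, hint, hext⟩, hAne, hpre⟩, ?_⟩, σ ∘ τ, hσ.comp hτ, ?_, fun α => ⟨?_, ?_⟩⟩
  · simp_rw [(hE _).2] at hvol
    exact tendsto_nhds_unique hvol tendsto_const_nhds
  · exact perimeter_le_liminf (fun n => (hcl _).measurableSet) hAcl.measurableSet hae
  · exact rieszEnergy_le_liminf hK (fun n => hcl _) (fun n => hR _) hAcl hA
  · exact rieszEnergy_le_liminf hK (fun n => isClosed_frontier) (fun n => hfrR _) hΓc.isClosed hΓ

theorem closedBall_mem_competitors (hd : 2 ≤ d) (hδ : 0 < δ)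
    (hm : volume.real (ball (0 : EuclideanSpace ℝ (Fin d)) 1) * δ ^ d ≤ m) :
    ∃ r, closedBall (0 : EuclideanSpace ℝ (Fin d)) r ∈ competitors d δ m := by
  have hd0 : d ≠ 0 := by omega
  set ω := volume.real (ball (0 : EuclideanSpace ℝ (Fin d)) 1) with hω
  have hω0 : 0 < ω :=
    ENNReal.toReal_pos (measure_ball_pos volume _ one_pos).ne' measure_ball_lt_top.ne
  have hmω : δ ^ d ≤ m / ω := by rw [le_div_iff₀ hω0]; linarith
  have hmω0 : 0 ≤ m / ω := (by positivity : 0 ≤ δ ^ d).trans hmω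
  -- The radius of the ball of volume `m`; the lower bound on `m` says exactly that `δ ≤ r`, so the
  -- inner ball fits.
  set r := (m / ω) ^ (1 / d : ℝ) with hr
  have hrd : r ^ d = m / ω := by
    rw [hr, ← Real.rpow_natCast, ← Real.rpow_mul hmω0, one_div_mul_cancel (by exact_mod_cast hd0),
      Real.rpow_one]
  have hr0 : 0 ≤ r := Real.rpow_nonneg hmω0 _
  have hδr : δ ≤ r := le_of_pow_le_pow_left₀ hd0 hr0 (hrd ▸ hmω)
  have hrpos : 0 < r := hδ.trans_le hδr
  have hball : ∀ x ∈ frontier (closedBall (0 : EuclideanSpace ℝ (Fin d)) r), ‖x‖ = r :=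
    fun x hx => by
      rw [frontier_closedBall _ hrpos.ne'] at hx
      simpa using hx
  -- The centres of the touching balls lie on the ray through `x`: `t = δ` gives the inner one, `t =
  -- -δ` the outer one.
  have hdist : ∀ (x : EuclideanSpace ℝ (Fin d)) (t : ℝ), ‖x‖ = r →
      dist x ((1 - t / r) • x) = |t| ∧ dist ((1 - t / r) • x) 0 = |r - t| := fun x t hx => by
    have h1 : x - (1 - t / r) • x = (t / r) • x := by module
    constructor
    · rw [dist_eq_norm, h1, norm_smul, hx, Real.norm_eq_abs, abs_div, abs_of_pos hrpos]
      field_simp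
    · rw [dist_zero_right, norm_smul, hx, Real.norm_eq_abs, one_sub_div hrpos.ne', abs_div,
        abs_of_pos hrpos]
      field_simp
  refine ⟨r, ⟨⟨⟨isClosed_closedBall, fun x hx => ?_, fun x hx => ?_⟩, ?_⟩, ?_⟩⟩
  · obtain ⟨h1, h2⟩ := hdist x δ (hball x hx)
    rw [abs_of_pos hδ] at h1
    rw [abs_of_nonneg (by linarith)] at h2
    exact ⟨_, h1, (ball_subset_ball' (by rw [h2]; linarith)).trans ball_subset_closedBall⟩
  · obtain ⟨h1, h2⟩ := hdist x (-δ) (hball x hx)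
    rw [abs_neg, abs_of_pos hδ] at h1
    rw [abs_of_nonneg (by linarith)] at h2
    refine ⟨_, h1, fun w hw hw' => ?_⟩
    have h3 := dist_triangle_left ((1 - -δ / r) • x) 0 w
    rw [h2] at h3
    have := mem_ball.1 hw
    have := mem_closedBall.1 hw'
    linarith
  · exact (convex_closedBall _ _).isConnected ⟨0, mem_closedBall_self hr0⟩
  · rw [Measure.addHaar_closedBall volume _ hr0, finrank_euclideanSpace_fin, hrd,
      ← ENNReal.ofReal_toReal (measure_ball_lt_top (μ := volume)
        (x := (0 : EuclideanSpace ℝ (Fin d))) (r := 1)).ne, ← ENNReal.ofReal_mul hmω0]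
    exact congrArg _ (div_mul_cancel₀ m hω0.ne')

/-- Translation invariant functionals that are lower semicontinuous on bounded sequences attain
their minimum among the competitors. -/
theorem exists_isMinOn_competitors (hd : 2 ≤ d) (hδ : 0 < δ)
    (hm : volume.real (ball (0 : EuclideanSpace ℝ (Fin d)) 1) * δ ^ d ≤ m)
    {Φ : Set (EuclideanSpace ℝ (Fin d)) → ℝ≥0∞}
    (hinv : ∀ a E, Φ (IsometryEquiv.addRight a '' E) = Φ E)
    (hlsc : ∀ (R : ℝ) (E : ℕ → Set (EuclideanSpace ℝ (Fin d))),
      (∀ n, E n ∈ competitors d δ m) → (∀ n, E n ⊆ closedBall 0 R) →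
      ∃ A ∈ competitors d δ m, ∃ σ : ℕ → ℕ, StrictMono σ ∧
        Φ A ≤ liminf (fun n => Φ (E (σ n))) atTop) :
    ∃ E ∈ competitors d δ m, IsMinOn Φ (competitors d δ m) E := by
  obtain ⟨r, hr⟩ := closedBall_mem_competitors hd hδ hm
  have hω0 : 0 < volume.real (ball (0 : EuclideanSpace ℝ (Fin d)) 1) :=
    ENNReal.toReal_pos (measure_ball_pos volume _ one_pos).ne' measure_ball_lt_top.ne
  obtain ⟨N, hN⟩ := exists_nat_gt (m / (δ ^ d * volume.real
    (ball (0 : EuclideanSpace ℝ (Fin d)) 1)))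
  rw [div_lt_iff₀ (by positivity)] at hN
  have hm0 : 0 ≤ m := (by positivity : (0 : ℝ) ≤ _).trans hm
  obtain ⟨u, -, hu, huS⟩ := exists_seq_tendsto_sInf (S := Φ '' competitors d δ m)
    ⟨_, mem_image_of_mem _ hr⟩ (OrderBot.bddBelow _)
  choose E hE hEu using huS
  choose x hx using fun n => (hE n).1.2.nonempty
  -- Moving a point of each set to the origin puts the whole sequence in one ball, by the diameter
  -- bound.
  obtain ⟨A, hA, σ, hσ, hle⟩ := hlsc (10 * δ * N)
    (fun n => IsometryEquiv.addRight (-x n) '' E n)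
    (fun n => image_addRight_mem_competitors _ (hE n)) (fun n => by
      rintro _ ⟨y, hy, rfl⟩
      have := dist_le_of_mem_competitors hδ hm0 hN (hE n) (hx n) hy
      simpa [dist_eq_norm, sub_eq_add_neg] using this)
  refine ⟨A, hA, fun B hB => hle.trans ?_⟩
  simp_rw [hinv, hEu]
  refine (hu.comp hσ.tendsto_atTop).liminf_eq.trans_le ?_
  exact sInf_le (mem_image_of_mem _ hB)

/-- Superadditivity of the lower limit; finiteness of `c` lets the factor pass through it. -/
theorem add_mul_le_liminf {u v : ℕ → ℝ≥0∞} {a b c : ℝ≥0∞} (hc : c ≠ ∞)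
    (ha : a ≤ liminf u atTop) (hb : b ≤ liminf v atTop) :
    a + c * b ≤ liminf (fun n => u n + c * v n) atTop := by
  refine (add_le_add ha ((mul_le_mul_right hb c).trans
    (ENNReal.liminf_const_mul_of_ne_top hc).ge)).trans ?_
  simp only [liminf_eq_iSup_iInf_of_nat]
  rw [ENNReal.iSup_add_iSup_of_monotone]
  · exact iSup_mono fun n => le_iInf₂ fun i hi => add_le_add (iInf₂_le i hi) (iInf₂_le i hi)
  · exact fun i j hij => le_iInf₂ fun k hk => iInf₂_le k (hij.trans hk)
  · exact fun i j hij => le_iInf₂ fun k hk => iInf₂_le k (hij.trans hk)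

end Compactness

end LiquidDrop

theorem mainTheorem5 (d : ℕ) (hd : 2 ≤ d) (α : ℝ) (hα : 0 < α) (hαd : α < d)
    (δ : ℝ) (hδ : 0 < δ) (m : ℝ)
    (hm : volume.real (ball (0 : EuclideanSpace ℝ (Fin d)) 1) * δ ^ d ≤ m)
    (Q : ℝ) (hQ : 0 ≤ Q) :
    (∃ E ∈ LiquidDrop.competitors d δ m,
      IsMinOn (LiquidDrop.functionalF α Q) (LiquidDrop.competitors d δ m) E) ∧
    (∃ E ∈ LiquidDrop.competitors d δ m,
      IsMinOn (LiquidDrop.functionalG α Q) (LiquidDrop.competitors d δ m) E) := by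
  refine ⟨LiquidDrop.exists_isMinOn_competitors hd hδ hm
      (LiquidDrop.functionalF_image_addRight α Q) fun R E hE hR => ?_,
    LiquidDrop.exists_isMinOn_competitors hd hδ hm
      (LiquidDrop.functionalG_image_addRight α Q) fun R E hE hR => ?_⟩
  · obtain ⟨A, hA, σ, hσ, hP, hI⟩ :=
      LiquidDrop.exists_limit_of_competitors (by omega) hδ hE hR
    exact ⟨A, hA, σ, hσ, LiquidDrop.add_mul_le_liminf ENNReal.ofReal_ne_top hP (hI α).1⟩
  · obtain ⟨A, hA, σ, hσ, hP, hI⟩ :=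
      LiquidDrop.exists_limit_of_competitors (by omega) hδ hE hR
    exact ⟨A, hA, σ, hσ, LiquidDrop.add_mul_le_liminf ENNReal.ofReal_ne_top hP (hI α).2⟩
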